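/- Conventions. An ordering is a reflexive, antisymmetric, transitive relation, and a poset is a set with an ordering. A barrier on $\omega$ is a family $B$ of pairwise $\subseteq$-incomparable non-empty finite subsets of $\omega$ such that every infinite $A\subseteq\omega$ has an initial segment that belongs to $B$. For $s,t\in B$ write $s\triangleleft t$ if $\min s<n$ for all $n\in t$ and $s\setminus\{\min s\}$ is an initial segment of $t$. A poset $Q$ is better quasi-ordered if for every barrier $B$ on $\omega$ and every $f\colon B\to Q$ there are $b_0,b_1\in B$ with $b_0\triangleleft b_1$ and $f(b_0)\le f(b_1)$. For a poset $P$, the poset algebra $F(P)$ is the Boolean algebra, unique up to isomorphism, generated by the image of an order-preserving injection $p\mapsto x_p$ of $P$ into $F(P)$, such that every order-preserving map $f$ from $P$ into a Boolean algebra $B$ extends to a Boolean homomorphism $\hat f\colon F(P)\to B$ with $\hat f(x_p)=f(p)$ for all $p\in P$. Let $L(P)$ be the sublattice of $F(P)$ generated by $\{x_p : p\in P\}$. The class $\mathcal B$ consists of all posets $P$ for which there is a (possibly empty) sublattice $G$ of $F(P)$ with $G\subseteq L(P)$ such that $G$ is better quasi-ordered by the ordering of $F(P)$ and generates $F(P)$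 as a Boolean algebra. Theorem 2.8. (a) Let $Q$ be a better quasi-ordered poset and let $P_\xi\in\mathcal B$ for every $\xi\in Q$. Then the lexicographic sum $\sum_{\xi\in Q}P_\xi$ (the disjoint union of the $P_\xi$, where $p\in P_\xi$ is below $q\in P_\zeta$ if and only if $\xi<\zeta$, or $\xi=\zeta$ and $p\le q$ in $P_\xi$) is in $\mathcal B$. (b) Let $(P,\le)$ be a poset, let $k$ be a natural number, and for $i<k$ let $\le_i$ be an ordering of a subset $P_i\subseteq P$ such that $(P_i,\le_i)\in\mathcal B$. If $\le\;=\;\le_0\cup\dots\cup\le_{k-1}$ as sets of pairs, then $(P,\le)\in\mathcal B$. -/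

import Mathlib

universe u v w

/-! ### Better quasi-orderings -/

/-- The set `s` is an initial segment of the set `A` of natural numbers. -/
def IsInitSeg (s A : Set ℕ) : Prop :=
  s ⊆ A ∧ ∀ a ∈ s, ∀ b ∈ A, b ≤ a → b ∈ s

/-- `B` is a barrier on the set `S` of natural numbers: a family of pairwise `⊆`-incomparable
non-empty finite subsets of `S` such that every infinite subset of `S` has an initial segment
in `B`. -/
structure IsBarrier (S : Set ℕ) (B : Set (Finset ℕ)) : Prop where
  infinite : S.Infinite
  nonempty : ∀ s ∈ B, s.Nonempty
  subset : ∀ s ∈ B, (s : Set ℕ) ⊆ S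
  incomparable : ∀ s ∈ B, ∀ t ∈ B, s ⊆ t → s = t
  exists_initSeg : ∀ A : Set ℕ, A ⊆ S → A.Infinite → ∃ s ∈ B, IsInitSeg (s : Set ℕ) A

/-- `s ◁ t`: writing `s = {n₀ < n₁ < ⋯ < n_k}`, one has `t = {n₁ < ⋯ < n_k < ⋯ < n_{k+l}}`
and all elements of `t` are larger than `n₀`. -/
def Precedes (s t : Finset ℕ) : Prop :=
  ∃ n ∈ s, (∀ m ∈ s, n ≤ m) ∧ (∀ m ∈ t, n < m) ∧
    IsInitSeg ((s.erase n : Finset ℕ) : Set ℕ) (t : Set ℕ)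

/-- An ordered set is better quasi-ordered if every map from a barrier on `ℕ` to it is good. -/
def IsBQO (α : Type u) [Preorder α] : Prop :=
  ∀ B : Set (Finset ℕ), IsBarrier Set.univ B → ∀ f : B → α,
    ∃ b₀ b₁ : B, Precedes (b₀ : Finset ℕ) (b₁ : Finset ℕ) ∧ f b₀ ≤ f b₁

/-! ### The poset algebra -/

/-- The set of all final segments (upper sets) of `P` that contain `p`. -/
def finalSegmentsThrough (P : Type u) [PartialOrder P] (p : P) : Set (UpperSet P) :=
  {R | p ∈ R}

/-- The poset algebra `F(P)`, realised as the algebra of sets of final segments of `P` generated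
by the sets `{R | p ∈ R}`, `p ∈ P`. The theorems below show that it has the properties that define
the poset algebra of `P` up to isomorphism over `P`. -/
abbrev PosetAlgebra (P : Type u) [PartialOrder P] : Type u :=
  ↥(BooleanSubalgebra.closure (Set.range (finalSegmentsThrough P)))

namespace PosetAlgebra

/-- The canonical generator `x_p` of `F(P)`. -/
def gen (P : Type u) [PartialOrder P] (p : P) : PosetAlgebra P :=
  ⟨finalSegmentsThrough P p, BooleanSubalgebra.subset_closure (Set.mem_range_self p)⟩

theorem gen_monotone (P : Type u) [PartialOrder P] : Monotone (gen P) := by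
  intro p q hpq R hR
  exact UpperSet.upper R hpq hR

theorem gen_injective (P : Type u) [PartialOrder P] : Function.Injective (gen P) := by
  have key : ∀ p q : P, gen P p = gen P q → p ≤ q := by
    intro p q h
    have h1 : finalSegmentsThrough P p = finalSegmentsThrough P q := congrArg Subtype.val h
    have h2 : UpperSet.Ici p ∈ finalSegmentsThrough P p := by
      simp [finalSegmentsThrough]
    rw [h1] at h2
    simpa [finalSegmentsThrough] using h2
  exact fun p q h => le_antisymm (key p q h) (key q p h.symm)

/-- `F(P)` is generated, as a Boolean algebra, by the elements `x_p`. -/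
theorem closure_range_gen (P : Type u) [PartialOrder P] :
    BooleanSubalgebra.closure (Set.range (gen P)) = ⊤ := by
  rw [eq_top_iff]
  rintro ⟨a, ha⟩ -
  induction ha using BooleanSubalgebra.closure_bot_sup_induction with
  | mem x hx =>
    obtain ⟨p, rfl⟩ := hx
    exact BooleanSubalgebra.subset_closure ⟨p, rfl⟩
  | bot => exact BooleanSubalgebra.bot_mem
  | sup x hx y hy h1 h2 => exact BooleanSubalgebra.sup_mem h1 h2
  | compl x hx h => exact BooleanSubalgebra.compl_mem h

/-- The universal property of `F(P)`: every order-preserving map into a Boolean algebra extends to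
a homomorphism of Boolean algebras. -/
theorem exists_lift (P : Type u) [PartialOrder P] (B : Type v) [BooleanAlgebra B]
    (f : P → B) (hf : Monotone f) :
    ∃ g : BoundedLatticeHom (PosetAlgebra P) B, ∀ p, g (gen P p) = f p := by
  classical
  let X := {J : Order.Ideal B // J.IsPrime}
  let Φ : X → UpperSet P := fun J =>
    ⟨{p | f p ∉ J.1}, fun p q hpq hp hq => hp (J.1.lower (hf hpq) hq)⟩
  let st : B → Set X := fun b => {J | b ∉ J.1}
  have st_sup : ∀ a b, st (a ⊔ b) = st a ∪ st b := by
    intro a b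
    ext J
    simp only [st, Set.mem_ofPred_eq, Set.mem_union, Order.Ideal.sup_mem_iff]
    tauto
  have st_inf : ∀ a b, st (a ⊓ b) = st a ∩ st b := by
    intro a b
    ext J
    simp only [st, Set.mem_ofPred_eq, Set.mem_inter_iff]
    constructor
    · exact fun h => ⟨fun ha => h (J.1.lower inf_le_left ha), fun hb => h (J.1.lower inf_le_right hb)⟩
    · rintro ⟨h1, h2⟩ h
      exact (J.2.mem_or_mem h).elim h1 h2
  have st_bot : st ⊥ = ∅ := by
    ext J
    simp [st]
  have st_top : st ⊤ = Set.univ := by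
    ext J
    have := J.2.toIsProper
    simpa [st] using Order.Ideal.IsProper.top_notMem this
  have st_compl : ∀ a, st aᶜ = (st a)ᶜ := by
    intro a
    refine (IsCompl.compl_eq ?_).symm
    rw [isCompl_iff, disjoint_iff, codisjoint_iff]
    constructor
    · change st a ∩ st aᶜ = ∅
      rw [← st_inf, inf_compl_eq_bot, st_bot]
    · change st a ∪ st aᶜ = Set.univ
      rw [← st_sup, sup_compl_eq_top, st_top]
  have st_le : ∀ a b, st a ⊆ st b → a ≤ b := by
    intro a b h
    by_contra hab
    have hdis : Disjoint ((Order.PFilter.principal a : Order.PFilter B) : Set B)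
        (Order.Ideal.principal b : Set B) := by
      rw [Set.disjoint_left]
      intro c hc hc'
      exact hab ((Order.PFilter.mem_principal.1 hc).trans (Order.Ideal.mem_principal.1 hc'))
    obtain ⟨J, hJ, hbJ, haJ⟩ := DistribLattice.prime_ideal_of_disjoint_filter_ideal hdis
    have h1 : (⟨J, hJ⟩ : X) ∈ st a := fun haJ' =>
      Set.disjoint_left.1 haJ (Order.PFilter.mem_principal.2 le_rfl) haJ'
    exact h h1 (hbJ (Order.Ideal.mem_principal.2 le_rfl))
  have st_inj : ∀ a b, st a = st b → a = b := fun a b h =>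
    le_antisymm (st_le a b h.subset) (st_le b a h.symm.subset)
  have hex : ∀ s : PosetAlgebra P, ∃ b : B, st b = Φ ⁻¹' s.1 := by
    rintro ⟨s, hs⟩
    induction hs using BooleanSubalgebra.closure_bot_sup_induction with
    | mem x hx =>
      obtain ⟨p, rfl⟩ := hx
      exact ⟨f p, rfl⟩
    | bot => exact ⟨⊥, st_bot⟩
    | sup x hx y hy h1 h2 =>
      obtain ⟨a, ha⟩ := h1
      obtain ⟨b, hb⟩ := h2
      refine ⟨a ⊔ b, ?_⟩
      rw [st_sup, ha, hb]
      rfl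
    | compl x hx h =>
      obtain ⟨a, ha⟩ := h
      refine ⟨aᶜ, ?_⟩
      rw [st_compl, ha]
      rfl
  choose g hg using hex
  refine ⟨{ toFun := g, map_sup' := ?_, map_inf' := ?_, map_top' := ?_, map_bot' := ?_ }, ?_⟩
  · intro a b
    apply st_inj
    rw [st_sup, hg, hg, hg]
    rfl
  · intro a b
    apply st_inj
    change st (g (a ⊓ b)) = st (g a ⊓ g b)
    rw [st_inf, hg, hg, hg]
    rfl
  · apply st_inj
    change st (g ⊤) = _
    rw [st_top, hg]
    rfl
  · apply st_inj
    change st (g ⊥) = _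
    rw [st_bot, hg]
    rfl
  · intro p
    apply st_inj
    change st (g (gen P p)) = _
    rw [hg]
    rfl

end PosetAlgebra

/-- The sublattice `L(P)` of `F(P)` generated by the elements `x_p`. -/
def posetLattice (P : Type u) [PartialOrder P] : Set (PosetAlgebra P) :=
  latticeClosure (Set.range (PosetAlgebra.gen P))

/-- `P` belongs to the class `𝓑`: some sublattice of `F(P)` contained in `L(P)` is better
quasi-ordered (under the ordering of `F(P)`) and generates the Boolean algebra `F(P)`. -/
def InClassB (P : Type u) [PartialOrder P] : Prop :=
  ∃ G : Sublattice (PosetAlgebra P),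
    (G : Set (PosetAlgebra P)) ⊆ posetLattice P ∧
    IsBQO G ∧
    BooleanSubalgebra.closure (G : Set (PosetAlgebra P)) = ⊤

/-! ### Barriers -/

/-! A monotone map `R → P` induces a homomorphism `F(R) → F(P)`. It carries a witness for `R ∈ 𝓑` to
a better quasi-ordered subset of `L(P)` that generates the images of the points of `R`
(`InClassB.exists_image`). Let `T` be the union of these subsets over all summands or pieces; it
generates `F(P)`. Since the sublattice generated by a better quasi-ordered subset of a distributive
lattice is better quasi-ordered (`IsBQOOn.latticeClosure`), it suffices that `T` is. In (b) `T` is a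
finite union (`IsBQOOn.biUnion`). In (a), for `ξ < ζ` every element of the `ξ`-th subset lies below
every element of the `ζ`-th, so `T` is a lexicographic union along `Q` (`IsBQOOn.iUnion_of_lt`).
Both kinds of union are handled by the Nash-Williams partition theorem; the lattice closure and the
lexicographic union also use the barrier of unions `s ∪ t` with `s ◁ t`. -/

theorem IsInitSeg.subset_or_subset {s t A : Set ℕ} (hs : IsInitSeg s A) (ht : IsInitSeg t A) :
    s ⊆ t ∨ t ⊆ s := by
  by_contra! h
  obtain ⟨⟨a, has, hat⟩, ⟨b, hbt, hbs⟩⟩ := Set.not_subset.1 h.1, Set.not_subset.1 h.2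
  rcases le_total a b with hab | hab
  · exact hat (ht.2 b hbt a (hs.1 has) hab)
  · exact hbs (hs.2 a has b (ht.1 hbt) hab)

theorem IsInitSeg.of_subset {s t A : Set ℕ} (hs : IsInitSeg s A) (ht : t ⊆ A) (hst : s ⊆ t) :
    IsInitSeg s t :=
  ⟨hst, fun a ha b hb hba => hs.2 a ha b (ht hb) hba⟩

theorem isInitSeg_union {s A : Set ℕ} (h : ∀ a ∈ s, ∀ b ∈ A, a < b) : IsInitSeg s (s ∪ A) :=
  ⟨Set.subset_union_left, fun a ha b hb hba =>
    hb.elim id fun hb => absurd hba (h a ha b hb).not_ge⟩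

theorem Set.Infinite.inter_Ioi {N : Set ℕ} (hN : N.Infinite) (m : ℕ) : (N ∩ Set.Ioi m).Infinite := by
  have h : N ∩ Set.Ioi m = N \ Set.Iic m := by
    ext
    simp
  exact h ▸ hN.sdiff (Set.finite_Iic m)

namespace IsBarrier

variable {S N : Set ℕ} {B : Set (Finset ℕ)} {s t : Finset ℕ}

theorem eq_of_isInitSeg (hB : IsBarrier S B) {A : Set ℕ} (hs : s ∈ B) (ht : t ∈ B)
    (hsA : IsInitSeg (s : Set ℕ) A) (htA : IsInitSeg (t : Set ℕ) A) : s = t := by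
  rcases hsA.subset_or_subset htA with h | h
  · exact hB.incomparable s hs t ht (Finset.coe_subset.1 h)
  · exact (hB.incomparable t ht s hs (Finset.coe_subset.1 h)).symm

theorem restrict (hB : IsBarrier S B) (hN : N.Infinite) (hNS : N ⊆ S) :
    IsBarrier N {s ∈ B | (s : Set ℕ) ⊆ N} where
  infinite := hN
  nonempty s hs := hB.nonempty s hs.1
  subset s hs := hs.2
  incomparable s hs t ht := hB.incomparable s hs.1 t ht.1
  exists_initSeg A hA hA' := by
    obtain ⟨s, hs, hsA⟩ := hB.exists_initSeg A (hA.trans hNS) hA'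
    exact ⟨s, ⟨hs, hsA.1.trans hA⟩, hsA⟩

/-- Source of the pairs `s ◁ t`: delete the least element of an infinite set. Incomparability rules
out `t ⊆ s \ {n}`, because `n ∈ s` but `n ∉ t`. -/
theorem precedes_of_isInitSeg (hB : IsBarrier S B) (hs : s ∈ B) (ht : t ∈ B) {A : Set ℕ} {n : ℕ}
    (hnA : n ∈ A) (hn : ∀ m ∈ A, n ≤ m) (hsA : IsInitSeg (s : Set ℕ) A)
    (htA : IsInitSeg (t : Set ℕ) (A \ {n})) : Precedes s t := by
  have hns : n ∈ s := by
    obtain ⟨m, hm⟩ := hB.nonempty s hs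
    exact hsA.2 m hm n hnA (hn m (hsA.1 hm))
  have hsA' : IsInitSeg ((s.erase n : Finset ℕ) : Set ℕ) (A \ {n}) := by
    rw [Finset.coe_erase]
    exact ⟨Set.sdiff_subset_sdiff_left hsA.1, fun a ha b hb hba => ⟨hsA.2 a ha.1 b hb.1 hba, hb.2⟩⟩
  have hnt : n ∉ t := fun h => (htA.1 h).2 rfl
  refine ⟨n, hns, fun m hm => hn m (hsA.1 hm), fun m hm => ?_, hsA'.of_subset htA.1 ?_⟩
  · exact lt_of_le_of_ne (hn m (htA.1 hm).1) fun h => hnt (h ▸ hm)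
  · refine (hsA'.subset_or_subset htA).resolve_right fun h => hnt ?_
    have hts : t ⊆ s := (Finset.coe_subset.1 h).trans (Finset.erase_subset _ _)
    rw [hB.incomparable t ht s hs hts]
    exact hns

end IsBarrier

namespace Precedes

variable {s t : Finset ℕ}

/-- If `s ◁ t`, then `s ∪ t` consists of `min s` followed by `t`. -/
theorem exists_union_eq (h : Precedes s t) :
    ∃ n ∈ s, (∀ m ∈ t, n < m) ∧ s ∪ t = insert n t := by
  obtain ⟨n, hn, -, hnt, hst⟩ := h
  refine ⟨n, hn, hnt, ?_⟩
  ext m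
  have := @hst.1 m
  simp only [Finset.coe_erase, Set.mem_sdiff, Finset.mem_coe, Set.mem_singleton_iff] at this
  simp only [Finset.mem_union, Finset.mem_insert]
  grind

theorem isInitSeg_union (h : Precedes s t) : IsInitSeg (s : Set ℕ) ((s ∪ t : Finset ℕ) : Set ℕ) := by
  obtain ⟨n, hn, hns, hnt, hst⟩ := h
  refine ⟨by simp, fun a ha b hb hba => ?_⟩
  simp only [Finset.coe_union, Set.mem_union, Finset.mem_coe] at hb ha ⊢
  refine hb.elim id fun hb => ?_
  have han : a ≠ n := fun h => (hnt b hb).not_ge (h ▸ hba)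
  have := hst.2 a (by simp [ha, han]) b hb hba
  exact Finset.mem_of_mem_erase this

end Precedes

/-- The family of all unions `s ∪ t` with `s ◁ t` in `B`. -/
def barrierSquare (B : Set (Finset ℕ)) : Set (Finset ℕ) :=
  {u | ∃ s ∈ B, ∃ t ∈ B, Precedes s t ∧ u = s ∪ t}

namespace IsBarrier

variable {S N : Set ℕ} {B : Set (Finset ℕ)}

theorem square (hB : IsBarrier S B) : IsBarrier S (barrierSquare B) where
  infinite := hB.infinite
  nonempty := by
    rintro _ ⟨s, hs, t, -, -, rfl⟩
    exact (hB.nonempty s hs).mono Finset.subset_union_left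
  subset := by
    rintro _ ⟨s, hs, t, ht, -, rfl⟩
    rw [Finset.coe_union]
    exact Set.union_subset (hB.subset s hs) (hB.subset t ht)
  incomparable := by
    rintro _ ⟨s, hs, t, ht, hst, rfl⟩ _ ⟨s', hs', t', ht', hst', rfl⟩ hsub
    obtain ⟨n, -, hnt, hu⟩ := hst.exists_union_eq
    obtain ⟨n', -, hnt', hu'⟩ := hst'.exists_union_eq
    rw [hu, hu'] at hsub ⊢
    have hn : n ∈ insert n' t' := hsub (Finset.mem_insert_self n t)
    -- The unions are `{n} ∪ t` and `{n'} ∪ t'` with least elements `n` and `n'`. The inclusion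
    -- gives `n' ≤ n`, so `n'` is not in `t`, whence `t ⊆ t'`.
    have hn't : n' ∉ t := by
      intro h
      have := hnt n' h
      rcases Finset.mem_insert.1 hn with h' | h'
      · omega
      · have := hnt' n h'
        omega
    have htt' : t = t' := hB.incomparable t ht t' ht' fun m hm =>
      (Finset.mem_insert.1 (hsub (Finset.mem_insert_of_mem hm))).resolve_left
        fun h => hn't (h ▸ hm)
    subst htt'
    rw [(Finset.mem_insert.1 hn).resolve_right fun h => lt_irrefl _ (hnt n h)]
  exists_initSeg A hA hA' := by
    obtain ⟨n, hnA, hn⟩ : ∃ n ∈ A, ∀ m ∈ A, n ≤ m :=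
      ⟨sInf A, Nat.sInf_mem hA'.nonempty, fun m hm => Nat.sInf_le hm⟩
    obtain ⟨s, hs, hsA⟩ := hB.exists_initSeg A hA hA'
    obtain ⟨t, ht, htA⟩ := hB.exists_initSeg (A \ {n}) (Set.sdiff_subset.trans hA)
      (hA'.sdiff (Set.finite_singleton n))
    refine ⟨s ∪ t, ⟨s, hs, t, ht, hB.precedes_of_isInitSeg hs ht hnA hn hsA htA, rfl⟩, ?_⟩
    rw [Finset.coe_union]
    refine ⟨Set.union_subset hsA.1 (htA.1.trans Set.sdiff_subset), ?_⟩
    rintro a (ha | ha) b hb hba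
    · exact Or.inl (hsA.2 a ha b hb hba)
    · rcases eq_or_ne b n with rfl | hbn
      · obtain ⟨m, hm⟩ := hB.nonempty s hs
        exact Or.inl (hsA.2 m hm b hb (hn m (hsA.1 hm)))
      · exact Or.inr (htA.2 a ha b ⟨hb, hbn⟩ hba)

/-- Consecutive elements of the square of a barrier overlap. -/
theorem eq_of_precedes_union (hB : IsBarrier S B) {s t s' t' : Finset ℕ} (ht : t ∈ B)
    (hs' : s' ∈ B) (hst : Precedes s t) (hst' : Precedes s' t')
    (h : Precedes (s ∪ t) (s' ∪ t')) : t = s' := by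
  obtain ⟨n, -, hnt, hu⟩ := hst.exists_union_eq
  obtain ⟨m, hm, hmu, -, hseg⟩ := h
  have hmn : m = n := by
    rw [hu] at hm hmu
    rcases Finset.mem_insert.1 hm with h | h
    · exact h
    · exact absurd (hmu n (Finset.mem_insert_self _ _)) (hnt m h).not_ge
  subst hmn
  -- Without its minimum, `s ∪ t` is `t`; thus `t` and `s'` are both initial segments of `s' ∪ t'`.
  rw [hu, Finset.erase_insert fun h => lt_irrefl _ (hnt m h)] at hseg
  exact hB.eq_of_isInitSeg ht hs' hseg hst'.isInitSeg_union

theorem union_injective (hB : IsBarrier S B) {s t s' t' : Finset ℕ} (hs : s ∈ B) (hs' : s' ∈ B)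
    (hst : Precedes s t) (hst' : Precedes s' t')
    (h : s ∪ t = s' ∪ t') : s = s' ∧ t = t' := by
  refine ⟨hB.eq_of_isInitSeg hs hs' hst.isInitSeg_union (h ▸ hst'.isInitSeg_union), ?_⟩
  obtain ⟨n, -, hnt, hu⟩ := hst.exists_union_eq
  obtain ⟨n', -, hnt', hu'⟩ := hst'.exists_union_eq
  rw [hu, hu'] at h
  have hn : n ∈ insert n' t' := h ▸ Finset.mem_insert_self n t
  have hn' : n' ∈ insert n t := h ▸ Finset.mem_insert_self n' t'
  have hnn : n = n' := by
    rcases Finset.mem_insert.1 hn with h1 | h1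
    · exact h1
    rcases Finset.mem_insert.1 hn' with h2 | h2
    · exact h2.symm
    · have := hnt _ h2
      have := hnt' _ h1
      omega
  subst hnn
  rw [← Finset.erase_insert fun h => lt_irrefl _ (hnt n h), h,
    Finset.erase_insert fun h => lt_irrefl _ (hnt' n h)]

theorem exists_precedes (hB : IsBarrier S B) : ∃ s ∈ B, ∃ t ∈ B, Precedes s t := by
  obtain ⟨_, ⟨s, hs, t, ht, hst, -⟩, -⟩ := hB.square.exists_initSeg S subset_rfl hB.infinite
  exact ⟨s, hs, t, ht, hst⟩

/-- A function on a barrier that is constant along `◁` is constant. -/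
theorem eq_of_forall_precedes {β : Type*} (hB : IsBarrier S B) (g : Finset ℕ → β)
    (hg : ∀ s ∈ B, ∀ t ∈ B, Precedes s t → g s = g t) {s t : Finset ℕ} (hs : s ∈ B) (ht : t ∈ B) :
    g s = g t := by
  -- Deleting the elements of `A` below `k` one at a time moves the initial segment in `B` along
  -- `◁`.
  have tail : ∀ A ⊆ S, A.Infinite → ∀ s ∈ B, IsInitSeg (s : Set ℕ) A → ∀ k : ℕ, ∀ t ∈ B,
      IsInitSeg (t : Set ℕ) (A ∩ Set.Ici k) → g s = g t := by
    intro A hA hA' s hs hsA k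
    induction k with
    | zero =>
      intro t ht htA
      rw [hB.eq_of_isInitSeg hs ht hsA (by simpa [Set.Ici_bot] using htA)]
    | succ k ih =>
      intro t ht htA
      by_cases hk : k ∈ A
      · have hinf : (A ∩ Set.Ici k).Infinite :=
          (hA'.inter_Ioi k).mono (Set.inter_subset_inter_right _ Set.Ioi_subset_Ici_self)
        obtain ⟨r, hr, hrA⟩ := hB.exists_initSeg (A ∩ Set.Ici k)
          (Set.inter_subset_left.trans hA) hinf
        rw [ih r hr hrA]
        refine hg r hr t ht (hB.precedes_of_isInitSeg hr ht (A := A ∩ Set.Ici k) (n := k)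
          ⟨hk, Set.mem_Ici.2 le_rfl⟩ (fun m hm => hm.2) hrA ?_)
        convert htA using 1
        ext m
        simp only [Set.mem_sdiff, Set.mem_inter_iff, Set.mem_Ici, Set.mem_singleton_iff]
        grind
      · refine ih t ht ?_
        convert htA using 1
        ext m
        simp only [Set.mem_inter_iff, Set.mem_Ici]
        grind
  -- With `A` equal to `s` followed by a tail of `S`, every `s` is linked to the same `r`, which
  -- depends only on the tail.
  have ext : ∀ s ∈ B, ∀ k, (∀ m ∈ s, m < k) → ∀ r ∈ B,
      IsInitSeg (r : Set ℕ) (S ∩ Set.Ici k) → g s = g r := by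
    intro s hs k hk r hr hrS
    have hinf : (S ∩ Set.Ici k).Infinite :=
      (hB.infinite.inter_Ioi k).mono (Set.inter_subset_inter_right _ Set.Ioi_subset_Ici_self)
    refine tail (s ∪ S ∩ Set.Ici k) (Set.union_subset (hB.subset s hs) Set.inter_subset_left)
      (hinf.mono Set.subset_union_right) s hs
      (isInitSeg_union fun a ha b hb => (hk a ha).trans_le hb.2) k r hr ?_
    convert hrS using 1
    ext m
    have := hk m
    simp only [Set.mem_inter_iff, Set.mem_union, Finset.mem_coe, Set.mem_Ici]
    grind
  obtain ⟨k, hk⟩ : ∃ k, ∀ m ∈ s ∪ t, m < k :=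
    ⟨(s ∪ t).sup id + 1, fun m hm => Nat.lt_succ_of_le (Finset.le_sup (f := id) hm)⟩
  have hinf : (S ∩ Set.Ici k).Infinite :=
    (hB.infinite.inter_Ioi k).mono (Set.inter_subset_inter_right _ Set.Ioi_subset_Ici_self)
  obtain ⟨r, hr, hrS⟩ := hB.exists_initSeg (S ∩ Set.Ici k) Set.inter_subset_left hinf
  rw [ext s hs k (fun m hm => hk m (Finset.mem_union_left _ hm)) r hr hrS,
    ext t ht k (fun m hm => hk m (Finset.mem_union_right _ hm)) r hr hrS]

end IsBarrier

/-! ### The Nash-Williams partition theorem -/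

/-- Every infinite subset of `S` has an infinite subset that is homogeneous for `c`. -/
def IsRamsey (S : Set ℕ) (c : Set ℕ → Prop) : Prop :=
  ∀ M ⊆ S, M.Infinite → ∃ N ⊆ M, N.Infinite ∧ ∃ p : Prop, ∀ A ⊆ N, A.Infinite → (c A ↔ p)

/-- Diagonal argument: shrink `X i` to `X (i + 1)` so that `c` is constant, with value `p (X i)`, on
the sets consisting of `n i = min (X i)` and an infinite part of `X (i + 1)`. One of the two values
occurs infinitely often, and the corresponding `n i` form a homogeneous set. -/
theorem isRamsey_of_forall_insert {S : Set ℕ} {c : Set ℕ → Prop} (k : ℕ)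
    (h : ∀ n ∈ S, k ≤ n → IsRamsey S fun A => c (insert n A)) : IsRamsey S c := by
  intro M hMS hM
  let T := {X : Set ℕ // X ⊆ S ∧ X.Infinite ∧ X ⊆ Set.Ici k}
  have hmin : ∀ X : T, sInf X.1 ∈ X.1 := fun X => Nat.sInf_mem X.2.2.1.nonempty
  have step : ∀ X : T, ∃ Y : T, ∃ p : Prop, Y.1 ⊆ X.1 ∧ Y.1 ⊆ Set.Ioi (sInf X.1) ∧
      ∀ A ⊆ Y.1, A.Infinite → (c (insert (sInf X.1) A) ↔ p) := by
    intro X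
    obtain ⟨N, hN, hN', p, hp⟩ := h _ (X.2.1 (hmin X)) (X.2.2.2 (hmin X))
      (X.1 ∩ Set.Ioi (sInf X.1)) (Set.inter_subset_left.trans X.2.1) (X.2.2.1.inter_Ioi _)
    have hNX := hN.trans Set.inter_subset_left
    exact ⟨⟨N, hNX.trans X.2.1, hN', hNX.trans X.2.2.2⟩, p, hNX,
      hN.trans Set.inter_subset_right, hp⟩
  choose next p hsub hgt hp using step
  let X₀ : T := ⟨M ∩ Set.Ici k, Set.inter_subset_left.trans hMS,
    (hM.inter_Ioi k).mono (Set.inter_subset_inter_right _ Set.Ioi_subset_Ici_self),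
    Set.inter_subset_right⟩
  let X : ℕ → T := fun i => Nat.rec X₀ (fun _ => next) i
  have hanti : Antitone fun i => (X i).1 := antitone_nat_of_succ_le fun i => hsub (X i)
  let n : ℕ → ℕ := fun i => sInf (X i).1
  have hmono : StrictMono n := strictMono_nat_of_lt_succ fun i => hgt (X i) (hmin (X (i + 1)))
  have key : ∀ I : Set ℕ, I.Infinite → ∀ q : Prop, (∀ i ∈ I, p (X i) ↔ q) →
      ∃ N ⊆ M, N.Infinite ∧ ∃ p : Prop, ∀ A ⊆ N, A.Infinite → (c A ↔ p) := by
    intro I hI q hq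
    refine ⟨n '' I, ?_, hI.image hmono.injective.injOn, q, fun A hA hA' => ?_⟩
    · rintro _ ⟨i, -, rfl⟩
      exact (hanti (Nat.zero_le i) (hmin (X i))).1
    · have ha : sInf A ∈ A := Nat.sInf_mem hA'.nonempty
      obtain ⟨i, hi, hia⟩ := hA ha
      rw [← hq i hi, ← hp (X i) (A \ {sInf A}) ?_ (hA'.sdiff (Set.finite_singleton _))]
      · change _ ↔ c (insert (n i) _)
        rw [hia, Set.insert_sdiff_singleton, Set.insert_eq_of_mem ha]
      · rintro m ⟨hm, hm'⟩
        obtain ⟨j, -, rfl⟩ := hA hm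
        have hij : n i < n j := hia ▸ lt_of_le_of_ne (Nat.sInf_le hm) (Ne.symm hm')
        exact hanti (Nat.succ_le_of_lt (hmono.lt_iff_lt.1 hij)) (hmin (X j))
  by_cases hI : {i | p (X i)}.Infinite
  · exact key _ hI True fun i hi => iff_true_intro hi
  · exact key _ (Set.not_infinite.1 hI).infinite_compl False fun i hi => iff_false_intro hi

namespace IsBarrier

variable {S : Set ℕ} {B : Set (Finset ℕ)}

/-- Call a finite `s` bad if `c (s ∪ ·)` is not Ramsey. If `∅` were bad, bad sets could be extended
forever by arbitrarily large numbers. The union `X` then has an initial segment `t ∈ B`, contained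
in some bad `s i`; but beyond `s i` the colour depends only on whether `t ∈ C`, a contradiction. -/
theorem isRamsey (hB : IsBarrier S B) (C : Set (Finset ℕ)) :
    IsRamsey S fun A => ∃ s ∈ B, s ∈ C ∧ IsInitSeg (s : Set ℕ) A := by
  set c : Set ℕ → Prop := fun A => ∃ s ∈ B, s ∈ C ∧ IsInitSeg (s : Set ℕ) A with hc
  by_contra hbad
  let T := {s : Finset ℕ // (s : Set ℕ) ⊆ S ∧ ¬ IsRamsey S fun A => c (s ∪ A)}
  have step : ∀ (k : ℕ) (s : T), ∃ s' : T, ∃ n ∈ s'.1, k ≤ n ∧ s.1 ⊆ s'.1 := by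
    intro k s
    by_contra! h
    refine s.2.2 (isRamsey_of_forall_insert k fun n hnS hn => ?_)
    by_contra hR
    refine h ⟨insert n s.1, ?_, ?_⟩ n (Finset.mem_insert_self _ _) hn (Finset.subset_insert _ _)
    · rw [Finset.coe_insert]
      exact Set.insert_subset hnS s.2.1
    · simpa only [Finset.coe_insert, Set.insert_union, Set.union_insert] using hR
  choose next n hn hkn hsub using step
  let s : ℕ → T := fun i => Nat.rec ⟨∅, by simp, by simpa using hbad⟩ next i
  have hmono : Monotone fun i => (s i).1 := monotone_nat_of_le_succ fun i => hsub i (s i)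
  let X : Set ℕ := ⋃ i, ((s i).1 : Set ℕ)
  have hXS : X ⊆ S := Set.iUnion_subset fun i => (s i).2.1
  have hX : X.Infinite := Set.infinite_of_forall_exists_gt fun i =>
    ⟨n (i + 1) (s (i + 1)), Set.mem_iUnion.2 ⟨i + 2, hn (i + 1) (s (i + 1))⟩,
      hkn (i + 1) (s (i + 1))⟩
  obtain ⟨t, ht, htX⟩ := hB.exists_initSeg X hXS hX
  obtain ⟨i, hi⟩ : ∃ i, t ⊆ (s i).1 := by
    have : ∀ m : t, ∃ i, (m : ℕ) ∈ (s i).1 := fun m => Set.mem_iUnion.1 (htX.1 m.2)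
    choose j hj using this
    refine ⟨Finset.univ.sup j, fun m hm => ?_⟩
    exact hmono (Finset.le_sup (Finset.mem_univ (⟨m, hm⟩ : t))) (hj ⟨m, hm⟩)
  have hts : IsInitSeg (t : Set ℕ) ((s i).1 : Set ℕ) :=
    htX.of_subset (Set.subset_iUnion (fun i => ((s i).1 : Set ℕ)) i) hi
  refine (s i).2.2 fun M hMS hM => ⟨M ∩ Set.Ioi ((s i).1.sup id), Set.inter_subset_left,
    hM.inter_Ioi _, t ∈ C, fun A hA _ => ?_⟩
  have htA : IsInitSeg (t : Set ℕ) ((s i).1 ∪ A) := by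
    have h := isInitSeg_union (s := ((s i).1 : Set ℕ)) (A := A) fun a ha b hb =>
      (Finset.le_sup (f := id) ha).trans_lt (hA hb).2
    refine ⟨hts.1.trans h.1, fun a ha b hb hba => hts.2 a ha b (h.2 a (hts.1 ha) b hb hba) hba⟩
  constructor
  · rintro ⟨r, hr, hrC, hrA⟩
    exact hB.eq_of_isInitSeg hr ht hrA htA ▸ hrC
  · exact fun h => ⟨t, ht, h, htA⟩

/-- The Nash-Williams partition theorem for barriers. -/
theorem exists_homogeneous (hB : IsBarrier S B) (C : Set (Finset ℕ)) :
    ∃ N ⊆ S, N.Infinite ∧ ((∀ s ∈ B, (s : Set ℕ) ⊆ N → s ∈ C) ∨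
      (∀ s ∈ B, (s : Set ℕ) ⊆ N → s ∉ C)) := by
  obtain ⟨N, hNS, hN, p, hp⟩ := hB.isRamsey C S subset_rfl hB.infinite
  have key : ∀ s ∈ B, (s : Set ℕ) ⊆ N → (s ∈ C ↔ p) := by
    intro s hs hsN
    have hsA := isInitSeg_union (s := (s : Set ℕ)) (A := N ∩ Set.Ioi (s.sup id)) fun a ha b hb =>
      (Finset.le_sup (f := id) ha).trans_lt hb.2
    rw [← hp (s ∪ N ∩ Set.Ioi (s.sup id)) (Set.union_subset hsN Set.inter_subset_left)
      ((hN.inter_Ioi _).mono Set.subset_union_right)]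
    refine ⟨fun h => ⟨s, hs, h, hsA⟩, ?_⟩
    rintro ⟨r, hr, hrC, hrA⟩
    exact hB.eq_of_isInitSeg hr hs hrA hsA ▸ hrC
  refine ⟨N, hNS, hN, ?_⟩
  by_cases h : p
  · exact Or.inl fun s hs hsN => (key s hs hsN).2 h
  · exact Or.inr fun s hs hsN hC => h ((key s hs hsN).1 hC)

end IsBarrier

/-! ### Better quasi-ordered sets -/

/-- The set `T` is better quasi-ordered by the relation `r`: every map from a barrier on an
infinite set of natural numbers to `T` is good. -/
def IsBQOOn {α : Type*} (r : α → α → Prop) (T : Set α) : Prop :=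
  ∀ (S : Set ℕ) (B : Set (Finset ℕ)), IsBarrier S B → ∀ f : Finset ℕ → α, (∀ s ∈ B, f s ∈ T) →
    ∃ s ∈ B, ∃ t ∈ B, Precedes s t ∧ r (f s) (f t)

theorem isInitSeg_map_iff (e : ℕ ↪o ℕ) {s A : Set ℕ} :
    IsInitSeg (e '' s) (e '' A) ↔ IsInitSeg s A := by
  simp [IsInitSeg, Set.image_subset_image_iff e.injective]

theorem Precedes.map (e : ℕ ↪o ℕ) {s t : Finset ℕ} (h : Precedes s t) :
    Precedes (s.map e.toEmbedding) (t.map e.toEmbedding) := by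
  obtain ⟨n, hn, hns, hnt, hst⟩ := h
  refine ⟨e n, by simpa using hn, by simpa using hns, by simpa using hnt, ?_⟩
  have : (s.map e.toEmbedding).erase (e n) = (s.erase n).map e.toEmbedding := by
    rw [Finset.map_erase]
    rfl
  rw [this, Finset.coe_map, Finset.coe_map]
  exact (isInitSeg_map_iff e).2 hst

/-- Pulling back along the increasing enumeration of `S` lets the definition on `ℕ` apply to
barriers on any infinite set, in particular after restriction. -/
theorem IsBarrier.comap (e : ℕ ↪o ℕ) {S : Set ℕ} (he : Set.range e = S) {B : Set (Finset ℕ)}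
    (hB : IsBarrier S B) : IsBarrier Set.univ {s | s.map e.toEmbedding ∈ B} where
  infinite := Set.infinite_univ
  nonempty s hs := by simpa using hB.nonempty _ hs
  subset s _ := Set.subset_univ _
  incomparable s hs t ht hst := by
    simpa using hB.incomparable _ hs _ ht (Finset.map_subset_map.2 hst)
  exists_initSeg A _ hA := by
    obtain ⟨t, ht, htA⟩ := hB.exists_initSeg (e '' A) (he ▸ Set.image_subset_range e A)
      (hA.image e.injective.injOn)
    obtain ⟨s, rfl⟩ : ∃ s : Finset ℕ, s.map e.toEmbedding = t := by
      refine ⟨t.preimage e e.injective.injOn, ?_⟩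
      ext m
      simp only [Finset.mem_map, Finset.mem_preimage]
      constructor
      · rintro ⟨a, ha, rfl⟩
        exact ha
      · intro hm
        obtain ⟨a, -, rfl⟩ := htA.1 hm
        exact ⟨a, hm, rfl⟩
    rw [Finset.coe_map] at htA
    exact ⟨s, ht, (isInitSeg_map_iff e).1 htA⟩

theorem isBQO_coe_iff {α : Type*} [Preorder α] {T : Set α} :
    IsBQO T ↔ IsBQOOn (· ≤ ·) T := by
  classical
  constructor
  · intro h S B hB f hf
    have := hB.infinite.to_subtype
    let e := Nat.orderEmbeddingOfSet S
    obtain ⟨b₀, b₁, hb, hle⟩ := h _ (hB.comap e (Nat.orderEmbeddingOfSet_range S))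
      fun s => ⟨f (s.1.map e.toEmbedding), hf _ s.2⟩
    exact ⟨_, b₀.2, _, b₁.2, hb.map e, hle⟩
  · intro h B hB f
    -- A member of `B` supplies the default value outside `B`.
    obtain ⟨s₀, hs₀, -⟩ := hB.exists_precedes
    obtain ⟨s, hs, t, ht, hst, hle⟩ := h _ B hB
      (fun s => if hs : s ∈ B then f ⟨s, hs⟩ else f ⟨s₀, hs₀⟩) fun s hs => by simp [hs]
    refine ⟨⟨s, hs⟩, ⟨t, ht⟩, hst, ?_⟩
    simpa [hs, ht] using hle

theorem IsBQO.isBQOOn_univ {α : Type*} [Preorder α] (h : IsBQO α) :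
    IsBQOOn (· ≤ ·) (Set.univ : Set α) := by
  classical
  intro S B hB f _
  have := hB.infinite.to_subtype
  let e := Nat.orderEmbeddingOfSet S
  obtain ⟨b₀, b₁, hb, hle⟩ := h _ (hB.comap e (Nat.orderEmbeddingOfSet_range S))
    fun s => f (s.1.map e.toEmbedding)
  exact ⟨_, b₀.2, _, b₁.2, hb.map e, hle⟩

namespace IsBQOOn

variable {α β : Type*} {r : α → α → Prop} {T T' : Set α}

theorem image {r' : β → β → Prop} (hT : IsBQOOn r T) (g : α → β)
    (hg : ∀ x ∈ T, ∀ y ∈ T, r x y → r' (g x) (g y)) : IsBQOOn r' (g '' T) := by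
  intro S B hB f hf
  have : Nonempty α := by
    obtain ⟨s, hs, -⟩ := hB.exists_precedes
    exact ⟨(hf s hs).choose⟩
  choose! x hxT hx using hf
  obtain ⟨s, hs, t, ht, hst, h⟩ := hT S B hB x hxT
  exact ⟨s, hs, t, ht, hst, hx s hs ▸ hx t ht ▸ hg _ (hxT s hs) _ (hxT t ht) h⟩

protected theorem empty : IsBQOOn r ∅ := by
  intro S B hB f hf
  obtain ⟨s, hs, -⟩ := hB.exists_precedes
  exact (hf s hs).elim

theorem union (hT : IsBQOOn r T) (hT' : IsBQOOn r T') : IsBQOOn r (T ∪ T') := by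
  intro S B hB f hf
  obtain ⟨N, hNS, hN, h⟩ := hB.exists_homogeneous {s | f s ∈ T}
  have hBN := hB.restrict hN hNS
  have key : ∃ s ∈ {s ∈ B | (s : Set ℕ) ⊆ N}, ∃ t ∈ {s ∈ B | (s : Set ℕ) ⊆ N},
      Precedes s t ∧ r (f s) (f t) := by
    rcases h with h | h
    · exact hT _ _ hBN f fun s hs => h s hs.1 hs.2
    · exact hT' _ _ hBN f fun s hs => (hf s hs.1).resolve_left (h s hs.1 hs.2)
  obtain ⟨s, hs, t, ht, hst⟩ := key
  exact ⟨s, hs.1, t, ht.1, hst⟩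

theorem biUnion {ι : Type*} (I : Finset ι) {T : ι → Set α} (hT : ∀ i, IsBQOOn r (T i)) :
    IsBQOOn r (⋃ i ∈ I, T i) := by
  classical
  induction I using Finset.induction_on with
  | empty => simpa using IsBQOOn.empty
  | insert i I _ ih => simpa using (hT i).union ih

/-- A function on the pairs `s ◁ t` of a barrier with values in a better quasi-ordered set is good
at two consecutive pairs. -/
theorem exists_consecutive (hT : IsBQOOn r T) {S : Set ℕ} {B : Set (Finset ℕ)}
    (hB : IsBarrier S B) (x : Finset ℕ → Finset ℕ → α)
    (hx : ∀ s ∈ B, ∀ t ∈ B, Precedes s t → x s t ∈ T) :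
    ∃ s ∈ B, ∃ t ∈ B, ∃ u ∈ B, Precedes s t ∧ Precedes t u ∧ r (x s t) (x t u) := by
  have hdec : ∀ u ∈ barrierSquare B, ∃ s ∈ B, ∃ t ∈ B, Precedes s t ∧ u = s ∪ t := fun u hu => hu
  choose! a ha b hb hab hu using hdec
  obtain ⟨u, hu₁, u', hu₁', hpre, h⟩ := hT S _ hB.square (fun u => x (a u) (b u))
    fun u hu => hx _ (ha u hu) _ (hb u hu) (hab u hu)
  have hba : b u = a u' := by
    refine hB.eq_of_precedes_union (hb u hu₁) (ha u' hu₁') (hab u hu₁) (hab u' hu₁') ?_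
    rwa [← hu u hu₁, ← hu u' hu₁']
  refine ⟨a u, ha u hu₁, b u, hb u hu₁, b u', hb u' hu₁', hab u hu₁, ?_, ?_⟩
  · exact hba ▸ hab u' hu₁'
  · simpa only [hba] using h

/-- If `f` is bad, each pair `s ◁ t` has a joinand `x s t` of `f s` not below `f t`. At consecutive
pairs with `x s t ≤ x t u` this fails, since `x t u ≤ f t`. The case of meets is dual. -/
theorem supClosure [SemilatticeSup α] {T : Set α} (hT : IsBQOOn (· ≤ ·) T) :
    IsBQOOn (· ≤ ·) (supClosure T) := by
  intro S B hB f hf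
  by_contra! hbad
  have : Nonempty α := ⟨f ∅⟩
  have hF : ∀ s ∈ B, ∃ F : Finset α, ∃ hF : F.Nonempty, ↑F ⊆ T ∧ F.sup' hF id = f s := hf
  choose! F hFne hFT hFf using hF
  have hx : ∀ s t, s ∈ B → t ∈ B → Precedes s t → ∃ x ∈ F s, ¬ x ≤ f t := by
    intro s t hs ht hst
    by_contra! h
    exact hbad s hs t ht hst (hFf s hs ▸ Finset.sup'_le _ _ h)
  choose! x hxF hx using hx
  obtain ⟨s, hs, t, ht, u, hu, hst, htu, h⟩ := hT.exists_consecutive hB x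
    fun s hs t ht hst => hFT s hs (hxF s t hs ht hst)
  refine hx s t hs ht hst (h.trans ?_)
  rw [← hFf t ht]
  exact Finset.le_sup' id (hxF t u ht hu htu)

theorem infClosure [SemilatticeInf α] {T : Set α} (hT : IsBQOOn (· ≤ ·) T) :
    IsBQOOn (· ≤ ·) (infClosure T) := by
  intro S B hB f hf
  by_contra! hbad
  have : Nonempty α := ⟨f ∅⟩
  have hF : ∀ s ∈ B, ∃ F : Finset α, ∃ hF : F.Nonempty, ↑F ⊆ T ∧ F.inf' hF id = f s := hf
  choose! F hFne hFT hFf using hF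
  have hx : ∀ s t, s ∈ B → t ∈ B → Precedes s t → ∃ x ∈ F t, ¬ f s ≤ x := by
    intro s t hs ht hst
    by_contra! h
    exact hbad s hs t ht hst (hFf t ht ▸ Finset.le_inf' _ _ h)
  choose! x hxF hx using hx
  obtain ⟨s, hs, t, ht, u, hu, hst, htu, h⟩ := hT.exists_consecutive hB x
    fun s hs t ht hst => hFT t ht (hxF s t hs ht hst)
  refine hx t u ht hu htu (le_trans ?_ h)
  rw [← hFf t ht]
  exact Finset.inf'_le id (hxF s t hs ht hst)

theorem latticeClosure [DistribLattice α] {T : Set α} (hT : IsBQOOn (· ≤ ·) T) :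
    IsBQOOn (· ≤ ·) (latticeClosure T) := by
  rw [← supClosure_infClosure]
  exact hT.infClosure.supClosure

/-- A lexicographic union of better quasi-ordered sets along a better quasi-ordered set is better
quasi-ordered. -/
theorem iUnion_of_lt {ι : Type*} [PartialOrder ι] (hι : IsBQO ι) {T : ι → Set α}
    (hT : ∀ i, IsBQOOn r (T i)) (hlt : ∀ i j, i < j → ∀ x ∈ T i, ∀ y ∈ T j, r x y) :
    IsBQOOn r (⋃ i, T i) := by
  intro S B hB f hf
  obtain ⟨s₀, hs₀, -⟩ := hB.exists_precedes
  obtain ⟨i₀, -⟩ := Set.mem_iUnion.1 (hf s₀ hs₀)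
  have : Nonempty ι := ⟨i₀⟩
  have hi : ∀ s ∈ B, ∃ i, f s ∈ T i := fun s hs => Set.mem_iUnion.1 (hf s hs)
  choose! i hi using hi
  -- Colour `s ◁ t` by whether the indices agree. Always agreeing, the index is constant and a
  -- single `T i` suffices; never agreeing, `i s ≤ i t` is strict and `hlt` applies.
  obtain ⟨N, hNS, hN, h⟩ := hB.square.exists_homogeneous
    {u | ∃ s ∈ B, ∃ t ∈ B, Precedes s t ∧ u = s ∪ t ∧ i s = i t}
  have hBN := hB.restrict hN hNS
  have hsub : ∀ s ∈ {s ∈ B | (s : Set ℕ) ⊆ N}, ∀ t ∈ {s ∈ B | (s : Set ℕ) ⊆ N},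
      ((s ∪ t : Finset ℕ) : Set ℕ) ⊆ N := by
    intro s hs t ht
    rw [Finset.coe_union]
    exact Set.union_subset hs.2 ht.2
  rcases h with h | h
  · have hconst : ∀ s ∈ {s ∈ B | (s : Set ℕ) ⊆ N}, ∀ t ∈ {s ∈ B | (s : Set ℕ) ⊆ N},
        Precedes s t → i s = i t := by
      intro s hs t ht hst
      obtain ⟨s', hs', t', ht', hst', heq, hi'⟩ :=
        h _ ⟨s, hs.1, t, ht.1, hst, rfl⟩ (hsub s hs t ht)
      obtain ⟨rfl, rfl⟩ := hB.union_injective hs.1 hs' hst hst' heq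
      exact hi'
    obtain ⟨s₁, hs₁, -⟩ := hBN.exists_precedes
    obtain ⟨s, hs, t, ht, hst⟩ := hT (i s₁) _ _ hBN f fun s hs =>
      hBN.eq_of_forall_precedes i hconst hs hs₁ ▸ hi s hs.1
    exact ⟨s, hs.1, t, ht.1, hst⟩
  · obtain ⟨s, hs, t, ht, hst, hle⟩ := hι.isBQOOn_univ _ _ hBN i fun _ _ => Set.mem_univ _
    refine ⟨s, hs.1, t, ht.1, hst, hlt _ _ (lt_of_le_of_ne hle fun heq => ?_) _ (hi s hs.1) _
      (hi t ht.1)⟩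
    exact h _ ⟨s, hs.1, t, ht.1, hst, rfl⟩ (hsub s hs t ht) ⟨s, hs.1, t, ht.1, hst, rfl, heq⟩

end IsBQOOn

/-! ### The class `𝓑` -/

theorem inClassB_of_isBQOOn {P : Type*} [PartialOrder P] {T : Set (PosetAlgebra P)}
    (hTL : T ⊆ posetLattice P) (hT : IsBQOOn (· ≤ ·) T)
    (hgen : ∀ p, PosetAlgebra.gen P p ∈ BooleanSubalgebra.closure T) : InClassB P := by
  have hL := isSublattice_latticeClosure (s := T)
  refine ⟨⟨latticeClosure T, hL.supClosed, hL.infClosed⟩,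
    latticeClosure_min hTL isSublattice_latticeClosure, isBQO_coe_iff.2 hT.latticeClosure, ?_⟩
  change BooleanSubalgebra.closure (latticeClosure T) = ⊤
  rw [BooleanSubalgebra.closure_latticeClosure, eq_top_iff, ← PosetAlgebra.closure_range_gen,
    BooleanSubalgebra.closure_le]
  exact Set.range_subset_iff.2 hgen

/-- A poset in `𝓑` that is mapped monotonically to `P` contributes to `F(P)` a better quasi-ordered
subset of `L(P)` that generates the images of its points. -/
theorem InClassB.exists_image {R P : Type*} [PartialOrder R] [PartialOrder P] (hR : InClassB R)
    (f : R → P) (hf : Monotone f) :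
    ∃ T : Set (PosetAlgebra P),
      T ⊆ latticeClosure (Set.range fun a => PosetAlgebra.gen P (f a)) ∧ IsBQOOn (· ≤ ·) T ∧
      ∀ a, PosetAlgebra.gen P (f a) ∈ BooleanSubalgebra.closure T := by
  obtain ⟨G, hGL, hG, hGtop⟩ := hR
  obtain ⟨g, hg⟩ := PosetAlgebra.exists_lift R (PosetAlgebra P) (fun a => PosetAlgebra.gen P (f a))
    ((PosetAlgebra.gen_monotone P).comp hf)
  refine ⟨g '' G, ?_, (isBQO_coe_iff.1 hG).image g fun x _ y _ h => OrderHomClass.mono g h,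
    fun a => ?_⟩
  · refine (Set.image_mono hGL).trans ?_
    rw [posetLattice, image_latticeClosure _ _ (map_sup g) (map_inf g), ← Set.range_comp]
    refine latticeClosure_mono (Set.range_subset_iff.2 fun a => ⟨a, (hg a).symm⟩)
  · have h : BooleanSubalgebra.closure (G : Set (PosetAlgebra R)) ≤
        (BooleanSubalgebra.closure (g '' G)).comap g :=
      BooleanSubalgebra.closure_le.2 fun x hx =>
        BooleanSubalgebra.subset_closure (Set.mem_image_of_mem g hx)
    rw [hGtop] at h
    exact hg a ▸ h (BooleanSubalgebra.mem_top (a := PosetAlgebra.gen R a))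

/-- Principal lower and upper sets `Set.Iic b` and `Set.Ici a` are sublattices. -/
theorem le_of_mem_latticeClosure {α : Type*} [Lattice α] {s t : Set α}
    (h : ∀ a ∈ s, ∀ b ∈ t, a ≤ b) {a b : α} (ha : a ∈ latticeClosure s)
    (hb : b ∈ latticeClosure t) : a ≤ b := by
  have hIic : ∀ b ∈ t, latticeClosure s ⊆ Set.Iic b := fun b hb =>
    latticeClosure_min (fun a ha => h a ha b hb)
      ⟨fun _ hx _ hy => sup_le hx hy, fun _ hx _ _ => inf_le_left.trans hx⟩
  have hIci : latticeClosure t ⊆ Set.Ici a :=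
    latticeClosure_min (fun b hb => hIic b hb ha)
      ⟨fun _ hx _ _ => le_sup_of_le_left hx, fun _ hx _ hy => le_inf hx hy⟩
  exact hIci hb

theorem InClassB.sigmaLex {Q : Type*} [PartialOrder Q] {P : Q → Type*} [∀ ξ, PartialOrder (P ξ)]
    (hQ : IsBQO Q) (hP : ∀ ξ, InClassB (P ξ)) : InClassB (Σₗ ξ, P ξ) := by
  have hmono : ∀ ξ, Monotone fun p : P ξ => (toLex ⟨ξ, p⟩ : Σₗ ξ, P ξ) :=
    fun ξ p q hpq => Sigma.Lex.right p q hpq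
  choose T hTL hT hgen using fun ξ => (hP ξ).exists_image _ (hmono ξ)
  refine inClassB_of_isBQOOn (T := ⋃ ξ, T ξ) ?_ (IsBQOOn.iUnion_of_lt hQ hT ?_) ?_
  · exact Set.iUnion_subset fun ξ => (hTL ξ).trans
      (latticeClosure_mono (Set.range_subset_iff.2 fun p => Set.mem_range_self _))
  · intro ξ ζ hlt x hx y hy
    refine le_of_mem_latticeClosure ?_ (hTL ξ hx) (hTL ζ hy)
    rintro _ ⟨p, rfl⟩ _ ⟨q, rfl⟩
    exact PosetAlgebra.gen_monotone _ (Sigma.Lex.left p q hlt)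
  · rintro ⟨ξ, p⟩
    exact BooleanSubalgebra.closure_mono (Set.subset_iUnion T ξ) (hgen ξ p)

/-- Only the points of `P` need covering; relations of `P` that come from no piece do no harm. -/
theorem InClassB.of_cover {P ι : Type*} [PartialOrder P] [Fintype ι] {R : ι → Type*}
    [∀ i, PartialOrder (R i)] (hR : ∀ i, InClassB (R i)) (f : ∀ i, R i → P)
    (hf : ∀ i, Monotone (f i)) (hcover : ∀ p, ∃ i a, f i a = p) : InClassB P := by
  choose T hTL hT hgen using fun i => (hR i).exists_image (f i) (hf i)
  refine inClassB_of_isBQOOn (T := ⋃ i, T i) ?_ ?_ ?_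
  · exact Set.iUnion_subset fun i => (hTL i).trans
      (latticeClosure_mono (Set.range_subset_iff.2 fun p => Set.mem_range_self _))
  · simpa using IsBQOOn.biUnion Finset.univ hT
  · intro p
    obtain ⟨i, a, rfl⟩ := hcover p
    exact BooleanSubalgebra.closure_mono (Set.subset_iUnion T i) (hgen i a)

theorem theorem2p8 :
    (∀ (Q : Type u) [PartialOrder Q] (P : Q → Type v) [∀ ξ, PartialOrder (P ξ)],
      IsBQO Q → (∀ ξ, InClassB (P ξ)) → InClassB (Σₗ ξ, P ξ)) ∧
    (∀ (P : Type w) [PartialOrder P] (k : ℕ) (S : Fin k → Set P)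
      (ord : ∀ i, PartialOrder (S i)),
      (∀ p q : P, p ≤ q ↔
        ∃ i, ∃ (hp : p ∈ S i) (hq : q ∈ S i), (ord i).le ⟨p, hp⟩ ⟨q, hq⟩) →
      (∀ i, @InClassB (S i) (ord i)) →
      InClassB P) := by
  refine ⟨fun Q _ P _ hQ hP => InClassB.sigmaLex hQ hP, fun P _ k S ord hle hS => ?_⟩
  refine @InClassB.of_cover P (Fin k) _ _ (fun i => S i) ord hS (fun i => Subtype.val) ?_ ?_
  · exact fun i a b hab => (hle a b).2 ⟨i, a.2, b.2, hab⟩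
  · intro p
    -- Reflexivity of `≤` makes the sets `S i` cover `P`.
    obtain ⟨i, hp, -⟩ := (hle p p).1 le_rfl
    exact ⟨i, ⟨p, hp⟩, rfl⟩
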